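/- **Geometry.** Let $Y\subset\mathbb R^n$ be open, with $\partial Y=\partial_NY\cup\partial_DY$ a disjoint decomposition. Let $Y\cup\partial_NY=\bigcup_{i\in I}\Omega_i$ be a finite partition into disjoint, non-empty connected submanifolds. For each $i\in I$ let $\mathfrak S_i$ be a finite rooted directed acyclic graph with root $i$; write $I_l$ for the set of (proper) descendants of a node $l$, and let the forest $\mathfrak F=\bigsqcup_{i\in I}\mathfrak S_i$ be the disjoint union of the sets of nodes. Every node $j\in\mathfrak F$ carries a bounded open set $X_j\subset\mathbb R^{d_j}$ with an orientation, such that $\overline X_j$ is a manifold with boundary $\overline X_j\setminus X_j$, and a smooth map $\phi_{0,j}:\overline X_j\to\mathbb R^n$ which is a diffeomorphism of $X_j$ onto $\Omega_{s_j}$ for some $s_j\in I$, with $s_i=i$ for the root $i$ of $\mathfrak S_i$. For every node $l$ and every $j\in I_l$ there is an injective smooth map $\phi_{l,j}:\overline X_j\to\overline X_l$ which restricts to a diffeomorphism of $X_j$ onto a subset of $\partial X_l$; put $\phi_{l,l}=\mathrm{id}$. The forest is assumed to be conforming: * $\phi_{l,j}=\phi_{l,m}\circ\phi_{m,j}$ and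 $\phi_{0,j}=\phi_{0,l}\circ\phi_{l,j}$ on $\overline X_j$ whenever $j\in I_m\cup\{m\}$ and $m\in I_l\cup\{l\}$; * for every node $l$, the sets $\phi_{l,j}(X_j)$, $j\in I_l\cup\{l\}$, are pairwise disjoint and their union is $\overline X_l\setminus\phi_{0,l}^{-1}(\partial_DY)$. For a node $j\in\mathfrak S_i$ let $\varepsilon_j=1$ if the orientation of $\Omega_{s_j}$ transported from $X_j$ by $\phi_{0,j}$ coincides with the one transported from $X_{s_j}$ (the domain of the root of $\mathfrak S_{s_j}$) by $\phi_{0,s_j}$, and $\varepsilon_j=-1$ otherwise. **Forms.** Let $k\ge 0$ be an integer. For $j\in\mathfrak S_i$ put $k_j=k-(n-d_i)$. A mixed-dimensional $k$-form $\mathfrak a\in\mathfrak L^k$ is a family $(a_j)_{j\in\mathfrak F}$ of alternating $k_j$-forms $a_j$ on $\Omega_{s_j}$, each represented by its pull-back under $\phi_{0,j}$ to $X_j$ (still denoted $a_j$), where $a_j=0$ if $k_j\notin\{0,\dots,d_j\}$. Writing $a_{j,\sigma}$ for the coefficients of $a_j$ in the standard basis, $\sigma$ running over the increasing selections of $k_j$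 values from $1,\dots,d_j$, let $$(\mathfrak a,\mathfrak b)_{\mathfrak F}=\sum_{j\in\mathfrak F}\int_{X_j}\sum_\sigma a_{j,\sigma}b_{j,\sigma}\,dx,\qquad \|\mathfrak a\|=(\mathfrak a,\mathfrak a)_{\mathfrak F}^{1/2},$$ and let $L^2\mathfrak L^k$ be the space of all $\mathfrak a\in\mathfrak L^k$ whose coefficients are all square integrable on the sets $X_j$. The space $C\mathfrak L^k$ of locally continuous forms consists of all $\mathfrak a\in\mathfrak L^k$ such that every $a_j$ is smooth on $\overline X_j\setminus\phi_{0,j}^{-1}(\partial_DY)$ with bounded derivatives of all orders, and $$a_j=\varepsilon_j\,\phi_{i,j}^*a_i\quad\text{on }X_j\qquad\text{for all } i\in I \text{ and all nodes } j\in\mathfrak S_i,\ j\ne i$$ (that is, $a_j$ is, up to the relative orientation, the trace of $a_i$ on the corresponding part of the boundary). **Theorem.** $C\mathfrak L^k$ is contained in $L^2\mathfrak L^k$ and is dense in it with respect to the norm $\|\cdot\|$: for every $\mathfrak a\in L^2\mathfrak L^k$ and every $\epsilon>0$ there is $\mathfrak b\in C\mathfrak L^k$ with $\|\mathfrak a-\mathfrak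 b\|<\epsilon$. -/

import Mathlib

open Set MeasureTheory
open scoped ContDiff

noncomputable section

/-- The Euclidean space `ℝ^d`. -/
abbrev Euc (d : ℕ) : Type := EuclideanSpace ℝ (Fin d)

/-- Alternating `m`-linear forms on `ℝ^d`. -/
abbrev AltForm (d m : ℕ) : Type := Euc d [⋀^Fin m]→L[ℝ] ℝ

/-- `closure X` is a (topological) manifold with boundary `closure X \ X`, for `X` open in `ℝ^d`:
every point of `closure X \ X` has a neighbourhood in `closure X` which is homeomorphic to an open
subset of a closed half-space, in such a way that the points of `X` are exactly those that are
mapped into the open half-space. (Points of the open set `X` need no chart.) -/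
def IsManifoldWithBoundaryClosure {d : ℕ} (X : Set (Euc d)) : Prop :=
  ∀ p : closure X, (p : Euc d) ∉ X →
    ∃ (c : Fin d) (e : OpenPartialHomeomorph (closure X) {y : Euc d // 0 ≤ y c}),
      p ∈ e.source ∧ ∀ q ∈ e.source, ((q : Euc d) ∈ X ↔ 0 < (e q : Euc d) c)

/-- `f` restricts to a diffeomorphism of the open set `X` onto its image, a subset of `ℝ^b`:
it is smooth on `X` and has a smooth inverse on `f '' X`. -/
def IsDiffeoOn {a b : ℕ} (f : Euc a → Euc b) (X : Set (Euc a)) : Prop :=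
  ContDiffOn ℝ ∞ f X ∧ ∃ g : Euc b → Euc a, ContDiffOn ℝ ∞ g (f '' X) ∧ LeftInvOn g f X

/-- A partition `Ω` of `Y ∪ ∂_N Y ⊆ ℝ^n`, indexed by `I`, together with a conforming forest.

The nodes of the tree rooted at `i : I` form the type `J i`. The tree (a rooted directed acyclic
graph) enters through its reachability order: `j < l` means that `j` is a descendant of `l`, and
the root is `⊤`. -/
structure ConformingForest (n : ℕ) (I : Type*) (J : I → Type*)
    [∀ i, PartialOrder (J i)] [∀ i, OrderTop (J i)] where
  /-- the domain -/
  Y : Set (Euc n)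
  isOpen_Y : IsOpen Y
  /-- the part `∂_N Y` of the boundary -/
  bdN : Set (Euc n)
  /-- the part `∂_D Y` of the boundary -/
  bdD : Set (Euc n)
  bd_union : bdN ∪ bdD = frontier Y
  bd_disjoint : Disjoint bdN bdD
  /-- the submanifolds of the partition -/
  Ω : I → Set (Euc n)
  Ω_connected : ∀ i, IsConnected (Ω i)
  Ω_disjoint : Pairwise fun i i' => Disjoint (Ω i) (Ω i')
  Ω_cover : ⋃ i, Ω i = Y ∪ bdN
  /-- the dimension `d_j` of a node -/
  dim : ∀ i, J i → ℕ
  /-- the reference domain `X_j` of a node -/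
  X : ∀ i (j : J i), Set (Euc (dim i j))
  X_isOpen : ∀ i j, IsOpen (X i j)
  X_isBounded : ∀ i j, Bornology.IsBounded (X i j)
  X_manifold : ∀ i j, IsManifoldWithBoundaryClosure (X i j)
  /-- the orientation of `X_j` (also meaningful in dimension zero, where it is a sign) -/
  orient : ∀ i (j : J i), Orientation ℝ (Euc (dim i j)) (Fin (dim i j))
  /-- `s_j`, the index of the submanifold on which a node is mapped -/
  s : ∀ i, J i → I
  s_root : ∀ i, s i ⊤ = i
  /-- the maps `φ_{0,j}` into physical space -/
  φ₀ : ∀ i (j : J i), Euc (dim i j) → Euc n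
  φ₀_smooth : ∀ i j, ContDiffOn ℝ ∞ (φ₀ i j) (closure (X i j))
  φ₀_diffeo : ∀ i j, IsDiffeoOn (φ₀ i j) (X i j)
  φ₀_image : ∀ i j, φ₀ i j '' X i j = Ω (s i j)
  /-- the maps `φ_{l,j}` between reference domains; only used for `j ≤ l` -/
  φ : ∀ i (l j : J i), Euc (dim i j) → Euc (dim i l)
  φ_self : ∀ i (j : J i), EqOn (φ i j j) id (closure (X i j))
  φ_smooth : ∀ i (l j : J i), j < l → ContDiffOn ℝ ∞ (φ i l j) (closure (X i j))
  φ_injOn : ∀ i (l j : J i), j < l → InjOn (φ i l j) (closure (X i j))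
  φ_diffeo : ∀ i (l j : J i), j < l → IsDiffeoOn (φ i l j) (X i j)
  φ_boundary : ∀ i (l j : J i), j < l → φ i l j '' X i j ⊆ frontier (X i l)
  /-- compound maps telescope -/
  φ_comp : ∀ i (l m j : J i), j ≤ m → m ≤ l →
    EqOn (φ i l j) (φ i l m ∘ φ i m j) (closure (X i j))
  φ₀_comp : ∀ i (l j : J i), j ≤ l → EqOn (φ₀ i j) (φ₀ i l ∘ φ i l j) (closure (X i j))
  /-- the subtree of every node covers the closed node, up to the Dirichlet boundary ... -/
  cover : ∀ i (l : J i),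
    ⋃ j ∈ Iic l, φ i l j '' X i j = closure (X i l) \ φ₀ i l ⁻¹' bdD
  /-- ... and does so uniquely -/
  cover_unique : ∀ i (l : J i), (Iic l).PairwiseDisjoint fun j => φ i l j '' X i j

namespace ConformingForest

variable {n : ℕ} {I : Type*} {J : I → Type*} [∀ i, PartialOrder (J i)] [∀ i, OrderTop (J i)]
variable (F : ConformingForest n I J)

/-- The positively oriented frames of the tangent space of `φ_{0,j}(X_j)` at `φ_{0,j}(x)`, for
the orientation transported from `X_j` by `φ_{0,j}`. -/
def posFrames (i : I) (j : J i) (x : Euc (F.dim i j)) : Set (List (Euc n)) :=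
  {L | ∃ b : Module.Basis (Fin (F.dim i j)) ℝ (Euc (F.dim i j)),
    b.orientation = F.orient i j ∧ L = List.ofFn fun t => fderiv ℝ (F.φ₀ i j) x (b t)}

open Classical in
/-- The relative orientation `ε(∂_j Ω_i, Ω_{s_j})`: it is `1` if the orientation of `∂_j Ω_i`
(transported from `X_j`) and that of `Ω_{s_j}` (transported from the root of the tree of `s_j`)
coincide, and `-1` otherwise. -/
def relOrient (i : I) (j : J i) : ℝ :=
  if ∀ x ∈ F.X i j, ∀ y ∈ F.X (F.s i j) ⊤, F.φ₀ i j x = F.φ₀ (F.s i j) ⊤ y →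
      F.posFrames i j x = F.posFrames (F.s i j) ⊤ y
  then 1 else -1

/-- The degree `k - (n - d_i)` of the local forms on the tree of `i`. If this integer is negative,
the value is irrelevant: the local forms are then zero by definition of `mixedForms`. -/
def deg (k : ℕ) (i : I) : ℕ := k + F.dim i ⊤ - n

/-- Families of local forms, one for every node `j` of the forest: the form `a_j` on `Ω_{s_j}` is
given by its pull-back under `φ_{0,j}` to the reference domain `X_j`. Only the values on `X_j` (and
its boundary, for traces) are relevant. -/
abbrev Family (k : ℕ) : Type _ :=
  ∀ i (j : J i), Euc (F.dim i j) → AltForm (F.dim i j) (F.deg k i)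

/-- The mixed-dimensional `k`-forms `𝔏^k`. The local forms are void (zero) on the trees for which
`k - (n - d_i)` is negative. (Where it exceeds `d_j`, they are zero automatically.) -/
def mixedForms (k : ℕ) : Set (F.Family k) :=
  {a | ∀ i, k + F.dim i ⊤ < n → a i = 0}

/-- The coefficient `a_σ` of a form in the standard basis, for an increasing selection `σ` of `m`
values from `1, …, d`. -/
def coef {d m : ℕ} (a : Euc d → AltForm d m) (σ : Fin m ↪o Fin d) (x : Euc d) : ℝ :=
  a x fun t => EuclideanSpace.single (σ t) 1

/-- Square integrable mixed-dimensional forms `L²𝔏^k` (as functions; forms that agree almost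
everywhere on all `X_j` have distance zero). -/
def L2Forms (k : ℕ) : Set (F.Family k) :=
  {a | a ∈ F.mixedForms k ∧
    ∀ i j σ, MemLp (coef (a i j) σ) 2 (volume.restrict (F.X i j))}

open Classical in
/-- The inner product of `L²𝔏^k`, with the Euclidean metric on the reference domains. -/
def innerL2 [Fintype I] [∀ i, Fintype (J i)] {k : ℕ} (a b : F.Family k) : ℝ :=
  ∑ i, ∑ j : J i, ∫ x in F.X i j, ∑ σ, coef (a i j) σ x * coef (b i j) σ x

/-- The norm of `L²𝔏^k`. -/
def normL2 [Fintype I] [∀ i, Fintype (J i)] {k : ℕ} (a : F.Family k) : ℝ :=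
  Real.sqrt (F.innerL2 a a)

/-- Smooth local forms: smooth on `X_j` and up to its boundary, apart from the part that lies on
`∂_D Y`, with bounded derivatives of all orders. -/
def IsSmoothLocal {m : ℕ} (i : I) (j : J i) (a : Euc (F.dim i j) → AltForm (F.dim i j) m) : Prop :=
  ContDiffOn ℝ ∞ a (closure (F.X i j) \ F.φ₀ i j ⁻¹' F.bdD) ∧
    ∀ r : ℕ, ∃ C : ℝ, ∀ x ∈ F.X i j, ‖iteratedFDeriv ℝ r a x‖ ≤ C

/-- The trace on `∂_j Ω_i` of a form `a` on `Ω_i` that is continuous up to `∂_j Ω_i`: its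
pull-back by `φ_{i,j}`, in the coordinates of `X_j`. -/
def trace {m : ℕ} (i : I) (j : J i) (a : Euc (F.dim i ⊤) → AltForm (F.dim i ⊤) m)
    (x : Euc (F.dim i j)) : AltForm (F.dim i j) m :=
  (a (F.φ i ⊤ j x)).compContinuousLinearMap (fderiv ℝ (F.φ i ⊤ j) x)

/-- Locally continuous mixed-dimensional forms `C𝔏^k`. -/
def CForms (k : ℕ) : Set (F.Family k) :=
  {a | a ∈ F.mixedForms k ∧ (∀ i j, F.IsSmoothLocal i j (a i j)) ∧
    ∀ i, ∀ j : J i, j ≠ ⊤ → ∀ x ∈ F.X i j, a i j x = F.relOrient i j • F.trace i j (a i ⊤) x}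

end ConformingForest

end

/-!
The trees of the forest do not interact, so that it suffices to approximate, on each tree, square
integrable forms `a_j` on its nodes. A locally continuous form is determined by its root form `B`:
on the other nodes it is, up to the sign `ε_j`, the pull-back of `B` by `φ_{i,j}`. Hence a smooth
form `B` on the ambient space of the root is needed whose pull-back to every node is `L²`-close to
`ε_j a_j`; the pull-back to the root itself, by the identity, is treated like all the others.

* The forms `ε_j a_j` are first replaced by smooth forms `c_j` with compact support `K_j` in `X_j`
  (`exists_contDiff_compact_eLpNorm_sub_le`).
* Since `φ_{i,j}` is an injective immersion of `X_j` and injective on the compact closure, `c_j` is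
  the pull-back of a smooth form `B_j` on the ambient space (`exists_contDiff_pullback_eq`).
* If `χ_j` is a cutoff function for a thin neighbourhood of `φ_{i,j}(K_j)`, then `χ_j B_j` still has
  pull-back `c_j` to `X_j`. The images of the other nodes, the root included, do not meet the
  compact set `φ_{i,j}(K_j)`. Therefore the part of `X_l` which is mapped to the neighbourhood shrinks to the
  empty set, and the pull-back of `χ_j B_j` to `X_l` tends to zero in `L²`
  (`eventually_eLpNorm_cutoff_smul_le`). The form `B = ∑ χ_j B_j` has the desired properties
  (`exists_contDiff_pullback_eLpNorm_sub_le`).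

The pull-backs of `B` are smooth up to the boundary with bounded derivatives, because `φ_{i,j}` is
smooth on the compact closure of `X_j` (`exists_contDiffOn_eq_fderiv`,
`exists_norm_iteratedFDeriv_le`). The manifold structure of the boundary plays no role in this.
-/

open Filter Topology

/-! ### Alternating forms on `ℝ^d` and their coefficients -/

/-- The coefficients of an alternating form in the standard basis, as a linear map. -/
noncomputable def coefMap (d m : ℕ) : AltForm d m →ₗ[ℝ] ((Fin m ↪o Fin d) → ℝ) where
  toFun w σ := w fun t => EuclideanSpace.single (σ t) 1
  map_add' _ _ := rfl
  map_smul' _ _ := rfl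

theorem coefMap_injective (d m : ℕ) : Function.Injective (coefMap d m) := by
  rw [injective_iff_map_eq_zero]
  intro w hw
  apply ContinuousAlternatingMap.toAlternatingMap_injective
  refine (EuclideanSpace.basisFun (Fin d) ℝ).toBasis.ext_alternating fun v hv => ?_
  -- sorting the indices turns an injective selection into an increasing one
  have hmono : StrictMono (v ∘ Tuple.sort v) :=
    (Tuple.monotone_sort v).strictMono_of_injective (hv.comp (Tuple.sort v).injective)
  have h0 := congrFun hw (OrderEmbedding.ofStrictMono _ hmono)
  have hperm := w.toAlternatingMap.map_perm
    (fun t => (EuclideanSpace.basisFun (Fin d) ℝ).toBasis (v t)) (Tuple.sort v)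
  have hz : w.toAlternatingMap ((fun t => (EuclideanSpace.basisFun (Fin d) ℝ).toBasis (v t)) ∘
      Tuple.sort v) = 0 := by
    simpa [coefMap, Function.comp_def] using h0
  rw [hz] at hperm
  have := (smul_eq_zero_iff_eq (Equiv.Perm.sign (Tuple.sort v))).1 hperm.symm
  simpa using this

instance finiteDimensional_altForm (d m : ℕ) : FiniteDimensional ℝ (AltForm d m) :=
  FiniteDimensional.of_injective (coefMap d m) (coefMap_injective d m)

/-- A form is recovered from its coefficients by a continuous linear map. -/
theorem exists_leftInverse_coefMap (d m : ℕ) :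
    ∃ R : ((Fin m ↪o Fin d) → ℝ) →L[ℝ] AltForm d m, ∀ w, R (coefMap d m w) = w := by
  obtain ⟨R, hR⟩ := (coefMap d m).exists_leftInverse_of_injective
    (LinearMap.ker_eq_bot.2 (coefMap_injective d m))
  exact ⟨LinearMap.toContinuousLinearMap R, fun w => LinearMap.congr_fun hR w⟩

/-- The pull-back `A^*w` of an alternating form depends smoothly on the pair `(w, A)`. -/
theorem contDiff_compContinuousLinearMap (a b m : ℕ) :
    ContDiff ℝ ∞ fun p : AltForm b m × (Euc a →L[ℝ] Euc b) =>
      p.1.compContinuousLinearMap p.2 := by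
  obtain ⟨R, hR⟩ := exists_leftInverse_coefMap a m
  have h1 : ContDiff ℝ ∞ fun p : AltForm b m × (Euc a →L[ℝ] Euc b) =>
      ContinuousMultilinearMap.compContinuousLinearMapContinuousMultilinear ℝ
        (fun _ : Fin m => Euc a) (fun _ => Euc b) ℝ (fun _ => p.2)
        (ContinuousAlternatingMap.toContinuousMultilinearMapCLM ℝ p.1) := by
    refine ContDiff.clm_apply ?_ ?_
    · exact (ContinuousMultilinearMap.contDiff _).comp (contDiff_pi.2 fun _ => contDiff_snd)
    · exact (ContinuousLinearMap.contDiff _).comp contDiff_fst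
  have h2 : ContDiff ℝ ∞ fun p : AltForm b m × (Euc a →L[ℝ] Euc b) =>
      coefMap a m (p.1.compContinuousLinearMap p.2) :=
    contDiff_pi.2 fun σ => (ContinuousMultilinearMap.apply ℝ (fun _ : Fin m => Euc a) ℝ
      (fun t => EuclideanSpace.single (σ t) 1)).contDiff.comp h1
  have h3 := R.contDiff.comp h2
  simp only [Function.comp_def, hR] at h3
  exact h3

theorem ContDiffOn.compContinuousLinearMap_altForm {a b m d : ℕ} {s : Set (Euc d)}
    {w : Euc d → AltForm b m} {A : Euc d → Euc a →L[ℝ] Euc b}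
    (hw : ContDiffOn ℝ ∞ w s) (hA : ContDiffOn ℝ ∞ A s) :
    ContDiffOn ℝ ∞ (fun x => (w x).compContinuousLinearMap (A x)) s :=
  (contDiff_compContinuousLinearMap a b m).comp_contDiffOn (hw.prodMk hA)

/-- The sum of the squares of the coefficients is bounded by a multiple of the squared norm. -/
theorem exists_sum_coefMap_sq_le (d m : ℕ) :
    ∃ C : ℝ, 0 < C ∧ ∀ w : AltForm d m, ∑ σ, coefMap d m w σ ^ 2 ≤ C * ‖w‖ ^ 2 := by
  set L : AltForm d m →L[ℝ] _ := LinearMap.toContinuousLinearMap (coefMap d m)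
  refine ⟨Fintype.card (Fin m ↪o Fin d) * ‖L‖ ^ 2 + 1, by positivity, fun w => ?_⟩
  have h : ∀ σ, coefMap d m w σ ^ 2 ≤ ‖L‖ ^ 2 * ‖w‖ ^ 2 := fun σ => by
    rw [← mul_pow, ← sq_abs]
    exact pow_le_pow_left₀ (abs_nonneg _) ((norm_le_pi_norm (L w) σ).trans (L.le_opNorm w)) 2
  calc ∑ σ, coefMap d m w σ ^ 2 ≤ ∑ _σ : Fin m ↪o Fin d, ‖L‖ ^ 2 * ‖w‖ ^ 2 :=
        Finset.sum_le_sum fun σ _ => h σ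
    _ = Fintype.card (Fin m ↪o Fin d) * ‖L‖ ^ 2 * ‖w‖ ^ 2 := by
        rw [Finset.sum_const, Finset.card_univ, nsmul_eq_mul, mul_assoc]
    _ ≤ _ := by nlinarith [sq_nonneg ‖w‖]

/-! ### Smooth functions up to the boundary of an open set -/

/-- A function that is smooth up to the boundary of `X` has a derivative which is again smooth up to
the boundary. No regularity of the boundary is needed: although `closure X` need not be a set of
unique differentiability, the derivatives from inside determine the jets by continuity. -/
theorem exists_contDiffOn_eq_fderiv {E G : Type*} [NormedAddCommGroup E] [NormedSpace ℝ E]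
    [NormedAddCommGroup G] [NormedSpace ℝ G] {f : E → G} {X : Set E} (hX : IsOpen X)
    (hf : ContDiffOn ℝ ∞ f (closure X)) :
    ∃ D : E → E →L[ℝ] G, ContDiffOn ℝ ∞ D (closure X) ∧ ∀ x ∈ X, D x = fderiv ℝ f x := by
  -- around each point of the closure, `f` has some derivative that is `C^m`
  have key : ∀ x ∈ closure X, ∀ m : ℕ, ∃ u ∈ 𝓝[closure X] x, ∃ f' : E → E →L[ℝ] G,
      x ∈ u ∧ ContDiffOn ℝ m f' u ∧
      ∀ y ∈ u ∩ X, f' y = fderiv ℝ f y := by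
    intro x hx m
    have h := (hf x hx).of_le (m := ((m : ℕ) : WithTop ℕ∞) + 1) (by exact_mod_cast le_top)
    obtain ⟨u, hu, -, f', hf', hc⟩ :=
      (contDiffWithinAt_succ_iff_hasFDerivWithinAt (by exact_mod_cast ENat.natCast_ne_top m)).1 h
    rw [insert_eq_of_mem hx] at hu
    have hxu : x ∈ u := mem_of_mem_nhdsWithin hx hu
    obtain ⟨v, hv, hvu, hcv⟩ := hc.contDiffOn' le_rfl (by simp)
    rw [insert_eq_of_mem hxu] at hcv
    obtain ⟨o, ho, hxo, hou⟩ := mem_nhdsWithin.1 hu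
    refine ⟨closure X ∩ (o ∩ v), inter_mem_nhdsWithin _ ((ho.inter hv).mem_nhds ⟨hxo, hvu⟩), f',
      ⟨hx, hxo, hvu⟩, hcv.mono ?_, ?_⟩
    · exact fun y hy => ⟨hou ⟨hy.2.1, hy.1⟩, hy.2.2⟩
    · rintro y ⟨⟨hyc, hyo, -⟩, hyX⟩
      have hn : u ∈ 𝓝 y := mem_of_superset ((ho.inter hX).mem_nhds ⟨hyo, hyX⟩)
        fun z hz => hou ⟨hz.1, subset_closure hz.2⟩
      exact ((hf' y (mem_of_mem_nhds hn)).hasFDerivAt hn).fderiv.symm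
  -- such a derivative is the limit of the derivatives in `X`, hence independent of choices
  have lim : ∀ x ∈ closure X, ∀ m : ℕ, ∃ u ∈ 𝓝[closure X] x, ∃ f' : E → E →L[ℝ] G,
      x ∈ u ∧ ContDiffOn ℝ m f' u ∧ ∀ y ∈ u, Tendsto (fderiv ℝ f) (𝓝[X] y) (𝓝 (f' y)) := by
    intro x hx m
    obtain ⟨u, hu, f', hxu, hc, he⟩ := key x hx m
    obtain ⟨o, ho, hxo, hou⟩ := mem_nhdsWithin.1 hu
    refine ⟨o ∩ closure X, inter_comm _ _ ▸ inter_mem_nhdsWithin _ (ho.mem_nhds hxo), f',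
      ⟨hxo, hx⟩, hc.mono hou, fun y hy => ?_⟩
    have h1 : Tendsto f' (𝓝[o ∩ X] y) (𝓝 (f' y)) :=
      ((hc.continuousOn y (hou hy)).mono fun z hz => hou ⟨hz.1, subset_closure hz.2⟩)
    have h2 : Tendsto (fderiv ℝ f) (𝓝[o ∩ X] y) (𝓝 (f' y)) :=
      h1.congr' (eventually_nhdsWithin_of_forall fun z hz =>
        he z ⟨hou ⟨hz.1, subset_closure hz.2⟩, hz.2⟩)
    rwa [inter_comm, nhdsWithin_inter_of_mem' (mem_nhdsWithin_of_mem_nhds (ho.mem_nhds hy.1))] at h2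
  have hlim : ∀ x ∈ closure X, ∀ A, Tendsto (fderiv ℝ f) (𝓝[X] x) (𝓝 A) →
      extendFrom X (fderiv ℝ f) x = A := fun x hx A hA => extendFrom_eq hx hA
  refine ⟨extendFrom X (fderiv ℝ f), fun x hx => ?_, fun x hxX => ?_⟩
  · rw [contDiffWithinAt_infty]
    intro m
    obtain ⟨u, hu, f', hxu, hc, ht⟩ := lim x hx m
    have h : ContDiffWithinAt ℝ m f' (u ∩ closure X) x := (hc x hxu).mono inter_subset_left
    have h' : ContDiffWithinAt ℝ m (extendFrom X (fderiv ℝ f)) (u ∩ closure X) x :=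
      h.congr (fun y hy => hlim y hy.2 _ (ht y hy.1)) (hlim x hx _ (ht x hxu))
    exact h'.mono_of_mem_nhdsWithin (inter_mem hu self_mem_nhdsWithin)
  · have := ((hf.mono subset_closure).fderiv_of_isOpen (m := ∞) hX le_rfl).continuousOn x hxX
    exact hlim x (subset_closure hxX) _ this

/-- A function that is smooth on the compact closure of an open set has bounded derivatives of all
orders inside. -/
theorem exists_norm_iteratedFDeriv_le {E G : Type*} [NormedAddCommGroup E] [NormedSpace ℝ E]
    [NormedAddCommGroup G] [NormedSpace ℝ G] {f : E → G} {X : Set E} (hX : IsOpen X)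
    (hc : IsCompact (closure X)) (hf : ContDiffOn ℝ ∞ f (closure X)) (r : ℕ) :
    ∃ C : ℝ, ∀ x ∈ X, ‖iteratedFDeriv ℝ r f x‖ ≤ C := by
  suffices h : ∃ C : ℝ, ∀ x ∈ closure X, x ∈ X → ‖iteratedFDeriv ℝ r f x‖ ≤ C by
    obtain ⟨C, hC⟩ := h
    exact ⟨C, fun x hx => hC x (subset_closure hx) hx⟩
  refine hc.induction_on (p := fun s => ∃ C : ℝ, ∀ x ∈ s, x ∈ X → ‖iteratedFDeriv ℝ r f x‖ ≤ C)
    ⟨0, by simp⟩ (fun s t hst ⟨C, hC⟩ => ⟨C, fun x hx => hC x (hst hx)⟩) ?_ ?_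
  · rintro s t ⟨C, hC⟩ ⟨C', hC'⟩
    refine ⟨max C C', fun x hx hxX => ?_⟩
    rcases hx with hx | hx
    · exact (hC x hx hxX).trans (le_max_left _ _)
    · exact (hC' x hx hxX).trans (le_max_right _ _)
  · intro x hx
    obtain ⟨u, hu, p, hp⟩ := (hf x hx).of_le (m := ((r : ℕ∞) : WithTop ℕ∞))
      (by exact_mod_cast le_top) r le_rfl
    rw [insert_eq_of_mem hx] at hu
    obtain ⟨o, ho, hxo, hou⟩ := mem_nhdsWithin.1 hu
    have hcont : ContinuousWithinAt (fun y => ‖p y r‖) (o ∩ closure X) x :=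
      ((hp.cont r le_rfl x (mem_of_mem_nhdsWithin hx hu)).mono hou).norm
    refine ⟨o ∩ closure X ∩ {y | ‖p y r‖ < ‖p x r‖ + 1}, ?_, ‖p x r‖ + 1, ?_⟩
    · have h1 : o ∩ closure X ∈ 𝓝[closure X] x :=
        inter_comm _ _ ▸ inter_mem_nhdsWithin _ (ho.mem_nhds hxo)
      refine inter_mem h1 ?_
      have := hcont.eventually (gt_mem_nhds (lt_add_one ‖p x r‖))
      rw [inter_comm, nhdsWithin_inter_of_mem' (mem_nhdsWithin_of_mem_nhds (ho.mem_nhds hxo))] at this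
      exact this
    · rintro y ⟨⟨hyo, -⟩, hy⟩ hyX
      have hoX : IsOpen (o ∩ X) := ho.inter hX
      have he := (hp.mono (show o ∩ X ⊆ u from fun z hz => hou ⟨hz.1, subset_closure hz.2⟩)
        ).eq_iteratedFDerivWithin_of_uniqueDiffOn le_rfl hoX.uniqueDiffOn ⟨hyo, hyX⟩
      rw [iteratedFDerivWithin_of_isOpen r hoX ⟨hyo, hyX⟩] at he
      rw [← he]
      exact le_of_lt hy

/-! ### Extending forms from an embedded open set -/

/-- A diffeomorphism onto its image is an immersion. The derivative of the inverse map within the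
image provides the left inverse, although it may not be unique. -/
theorem IsDiffeoOn.exists_leftInverse_fderiv {a b : ℕ} {f : Euc a → Euc b} {X : Set (Euc a)}
    (h : IsDiffeoOn f X) (hX : IsOpen X) {x : Euc a} (hx : x ∈ X) :
    ∃ L : Euc b →L[ℝ] Euc a, L ∘L fderiv ℝ f x = ContinuousLinearMap.id ℝ _ := by
  obtain ⟨hf, g, hg, hgf⟩ := h
  have h1 : HasFDerivAt f (fderiv ℝ f x) x :=
    ((hf.contDiffAt (hX.mem_nhds hx)).differentiableAt (by simp)).hasFDerivAt
  have h2 := (hg.differentiableOn (by simp) (f x) (mem_image_of_mem f hx)).hasFDerivWithinAt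
  have h3 := (h2.comp x h1.hasFDerivWithinAt (mapsTo_image f X)).hasFDerivAt (hX.mem_nhds hx)
  have h4 : HasFDerivAt (g ∘ f) (ContinuousLinearMap.id ℝ _) x :=
    (hasFDerivAt_id x).congr_of_eventuallyEq (eventually_of_mem (hX.mem_nhds hx) hgf)
  exact ⟨_, h3.unique h4⟩

/-- A smooth map with an injective derivative at `x` has near `x` a left inverse which is smooth on
an open set of the target. -/
theorem exists_local_smooth_leftInverse {a b : ℕ} {f : Euc a → Euc b} {X : Set (Euc a)}
    (hX : IsOpen X) (hf : ContDiffOn ℝ ∞ f X) {x : Euc a} (hx : x ∈ X) {L : Euc b →L[ℝ] Euc a}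
    (hL : L ∘L fderiv ℝ f x = ContinuousLinearMap.id ℝ _) :
    ∃ (O : Set (Euc a)) (W : Set (Euc b)) (g : Euc b → Euc a), IsOpen O ∧ IsOpen W ∧ x ∈ O ∧
      O ⊆ X ∧ f x ∈ W ∧ ContDiffOn ℝ ∞ g W ∧ ∀ y ∈ O, g (f y) = y := by
  have hh : ContDiffOn ℝ ∞ (L ∘ f) X := L.contDiff.comp_contDiffOn hf
  have hd : ∀ y ∈ X, HasFDerivAt (L ∘ f) (L ∘L fderiv ℝ f y) y := fun y hy =>
    L.hasFDerivAt.comp y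
      ((hf.contDiffAt (hX.mem_nhds hy)).differentiableAt (by simp)).hasFDerivAt
  have hdx : HasFDerivAt (L ∘ f)
      ((ContinuousLinearEquiv.refl ℝ (Euc a) : Euc a ≃L[ℝ] Euc a) : Euc a →L[ℝ] Euc a) x := by
    have := hd x hx
    rwa [hL] at this
  have hca : ContDiffAt ℝ ∞ (L ∘ f) x := hh.contDiffAt (hX.mem_nhds hx)
  set e := hca.toOpenPartialHomeomorph (L ∘ f) hdx (by simp)
  have hxe : x ∈ e.source := hca.mem_toOpenPartialHomeomorph_source hdx (by simp)
  -- the derivative of `L ∘ f` stays invertible near `x`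
  have hcont : ContinuousOn (fun y => L ∘L fderiv ℝ f y) X :=
    continuousOn_const.clm_comp (hf.fderiv_of_isOpen (m := ∞) hX le_rfl).continuousOn
  set O : Set (Euc a) := e.source ∩ (X ∩ (fun y => L ∘L fderiv ℝ f y) ⁻¹'
    range ((↑) : (Euc a ≃L[ℝ] Euc a) → Euc a →L[ℝ] Euc a))
  have hOo : IsOpen O := e.open_source.inter
    (hcont.isOpen_inter_preimage hX ContinuousLinearEquiv.isOpen)
  have hxO : x ∈ O := ⟨hxe, hx, ContinuousLinearEquiv.refl ℝ _, by simp [hL]⟩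
  have hOs : O ⊆ e.source := inter_subset_left
  refine ⟨O, L ⁻¹' (e '' O), e.symm ∘ L, hOo, ?_, hxO, fun y hy => hy.2.1,
    ⟨x, hxO, rfl⟩, ?_, fun y hy => e.left_inv (hOs hy)⟩
  · exact (e.isOpen_image_of_subset_source hOo hOs).preimage L.continuous
  · refine ContDiffOn.comp (t := e '' O) ?_ L.contDiff.contDiffOn (mapsTo_preimage _ _)
    rintro _ ⟨y, hy, rfl⟩
    obtain ⟨A, hA⟩ := hy.2.2
    have hsymm : e.symm (e y) = y := e.left_inv (hOs hy)
    refine (e.contDiffAt_symm (f₀' := A) (e.map_source (hOs hy)) ?_ ?_).contDiffWithinAt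
    · rw [hsymm, hA]
      exact hd y hy.2.1
    · rw [hsymm]
      exact hh.contDiffAt (hX.mem_nhds hy.2.1)

/-- Every smooth form with compact support in an open set `X` that is embedded by `f` is the
pull-back by `f` of a smooth form on the whole target space: the forms on the target space that
have the prescribed pull-back at a point form a convex set, so that local solutions can be glued by
a partition of unity. -/
theorem exists_contDiff_pullback_eq {a b m : ℕ} {f : Euc a → Euc b} {X K : Set (Euc a)}
    (hX : IsOpen X) (hXc : IsCompact (closure X)) (hf : ContDiffOn ℝ ∞ f (closure X))
    (hinj : InjOn f (closure X)) (hdiff : IsDiffeoOn f X) (hK : IsCompact K) (hKX : K ⊆ X)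
    {c : Euc a → AltForm a m} (hc : ContDiff ℝ ∞ c) (hcK : ∀ x ∉ K, c x = 0) :
    ∃ B : Euc b → AltForm b m, ContDiff ℝ ∞ B ∧
      ∀ x ∈ X, (B (f x)).compContinuousLinearMap (fderiv ℝ f x) = c x := by
  let t : Euc b → Set (AltForm b m) := fun y =>
    {w | ∀ x ∈ X, f x = y → w.compContinuousLinearMap (fderiv ℝ f x) = c x}
  have ht : ∀ y, Convex ℝ (t y) := by
    intro y w hw w' hw' p q _ _ hpq x hx hxy
    have h1 := hw x hx hxy
    have h2 := hw' x hx hxy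
    have : (p • w + q • w').compContinuousLinearMap (fderiv ℝ f x) =
        p • w.compContinuousLinearMap (fderiv ℝ f x) +
          q • w'.compContinuousLinearMap (fderiv ℝ f x) := by
      ext v; simp
    rw [this, h1, h2, ← add_smul, hpq, one_smul]
  have hfc : ContinuousOn f (closure X) := hf.continuousOn
  suffices hloc : ∀ y, ∃ U ∈ 𝓝 y, ∃ g : Euc b → AltForm b m, ContDiffOn ℝ ∞ g U ∧
      ∀ z ∈ U, g z ∈ t z by
    obtain ⟨g, hg⟩ := exists_contMDiffMap_forall_mem_convex_of_local
      (modelWithCornersSelf ℝ (Euc b)) (n := (⊤ : ℕ∞)) ht fun y => by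
        obtain ⟨U, hU, g, hg, hgt⟩ := hloc y
        exact ⟨U, hU, g, hg.contMDiffOn, hgt⟩
    exact ⟨g, g.contMDiff.contDiff, fun x hx => hg (f x) x hx rfl⟩
  intro y
  by_cases hy : y ∈ f '' K
  · obtain ⟨x, hxK, rfl⟩ := hy
    obtain ⟨L, hL⟩ := hdiff.exists_leftInverse_fderiv hX (hKX hxK)
    obtain ⟨O, W, g, hO, hW, hxO, hOX, hxW, hg, hgf⟩ :=
      exists_local_smooth_leftInverse hX hdiff.1 (hKX hxK) hL
    -- `f` sends the points outside of `O` to a compact set that does not contain `f x`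
    have hclosed : IsClosed (f '' (closure X \ O)) :=
      ((hXc.diff hO).image_of_continuousOn (hfc.mono sdiff_subset)).isClosed
    have hxn : f x ∉ f '' (closure X \ O) := by
      rintro ⟨z, hz, hzx⟩
      exact hz.2 (hinj hz.1 (subset_closure (hKX hxK)) hzx ▸ hxO)
    have hVo : IsOpen (W ∩ (f '' (closure X \ O))ᶜ) := hW.inter hclosed.isOpen_compl
    refine ⟨_, hVo.mem_nhds ⟨hxW, hxn⟩,
      fun z => (c (g z)).compContinuousLinearMap (fderiv ℝ g z), ?_, ?_⟩
    · have hgV := hg.mono (inter_subset_left (t := (f '' (closure X \ O))ᶜ))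
      exact (hc.comp_contDiffOn hgV).compContinuousLinearMap_altForm
        (hgV.fderiv_of_isOpen (m := ∞) hVo le_rfl)
    · rintro _ ⟨hzW, hzn⟩ z hz rfl
      have hzO : z ∈ O := by
        by_contra hzO
        exact hzn ⟨z, ⟨subset_closure hz, hzO⟩, rfl⟩
      have h1 : HasFDerivAt g (fderiv ℝ g (f z)) (f z) :=
        ((hg.contDiffAt (hW.mem_nhds hzW)).differentiableAt (by simp)).hasFDerivAt
      have h2 : HasFDerivAt f (fderiv ℝ f z) z :=
        ((hdiff.1.contDiffAt (hX.mem_nhds hz)).differentiableAt (by simp)).hasFDerivAt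
      have h3 : HasFDerivAt (g ∘ f) (ContinuousLinearMap.id ℝ _) z :=
        (hasFDerivAt_id z).congr_of_eventuallyEq (eventually_of_mem (hO.mem_nhds hzO) hgf)
      have h4 := (h1.comp z h2).unique h3
      ext v
      have h5 : ∀ i, fderiv ℝ g (f z) (fderiv ℝ f z (v i)) = v i := fun i =>
        DFunLike.congr_fun h4 (v i)
      simp [Function.comp_def, h5, hgf z hzO]
  · have hKc : IsClosed (f '' K) :=
      (hK.image_of_continuousOn (hfc.mono (hKX.trans subset_closure))).isClosed
    refine ⟨_, hKc.isOpen_compl.mem_nhds hy, fun _ => 0, contDiffOn_const, ?_⟩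
    rintro _ hz x hx rfl
    have : c x = 0 := hcK x fun h => hz ⟨x, h, rfl⟩
    rw [this]
    ext v
    simp

/-! ### Approximation in `L²` -/

theorem exists_contDiff_cutoff {b : ℕ} {A U : Set (Euc b)} (hA : IsClosed A) (hU : IsOpen U)
    (hAU : A ⊆ U) :
    ∃ χ : Euc b → ℝ, ContDiff ℝ ∞ χ ∧ (∀ y ∈ A, χ y = 1) ∧ (∀ y ∉ U, χ y = 0) ∧
      ∀ y, χ y ∈ Icc 0 1 := by
  obtain ⟨χ, h0, h1, h⟩ := exists_contMDiffMap_zero_one_of_isClosed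
    (modelWithCornersSelf ℝ (Euc b)) (n := (⊤ : ℕ∞)) hU.isClosed_compl hA
    (disjoint_compl_left_iff_subset.2 hAU)
  exact ⟨χ, χ.contMDiff.contDiff, fun y hy => h1 hy, fun y hy => h0 hy, h⟩

theorem memLp_two_of_continuousOn_of_bound {a : ℕ} {G : Type*} [NormedAddCommGroup G]
    {X : Set (Euc a)} (hX : IsOpen X) (hXb : Bornology.IsBounded X) {g : Euc a → G}
    (hg : ContinuousOn g X) {C : ℝ} (hC : ∀ x ∈ X, ‖g x‖ ≤ C) :
    MemLp g 2 (volume.restrict X) := by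
  have : IsFiniteMeasure (volume.restrict X) := ⟨by simpa using hXb.measure_lt_top⟩
  exact MemLp.of_bound (hg.aestronglyMeasurable hX.measurableSet) C
    (ae_restrict_of_forall_mem hX.measurableSet hC)

/-- Smooth functions with compact support in an open set `X` are dense in `L²(X)`. -/
theorem exists_contDiff_compact_eLpNorm_sub_le {a : ℕ} {G : Type*} [NormedAddCommGroup G]
    [NormedSpace ℝ G] {X : Set (Euc a)} (hX : IsOpen X) (hXb : Bornology.IsBounded X)
    {u : Euc a → G} (hu : MemLp u 2 (volume.restrict X)) {ε : ℝ} (hε : 0 < ε) :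
    ∃ (c : Euc a → G) (K : Set (Euc a)), ContDiff ℝ ∞ c ∧ IsCompact K ∧ K ⊆ X ∧
      (∀ x ∉ K, c x = 0) ∧ eLpNorm (u - c) 2 (volume.restrict X) ≤ ENNReal.ofReal ε := by
  obtain ⟨g, hgc, hg, hug⟩ := hu.exist_eLpNorm_sub_le (by simp) (by simp) (half_pos hε)
  have hgm : MemLp g 2 (volume.restrict X) := hg.continuous.memLp_of_hasCompactSupport hgc
  obtain ⟨δ, hδ, hgδ⟩ := hgm.eLpNorm_indicator_le (by simp) (by simp) (half_pos hε)
  obtain ⟨K, hKX, hK, hKδ⟩ := hX.measurableSet.exists_isCompact_sdiff_lt (μ := volume)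
    hXb.measure_lt_top.ne (ENNReal.ofReal_pos.2 hδ).ne'
  obtain ⟨K', hK', hKK', hK'X⟩ := exists_compact_between hK hX hKX
  obtain ⟨χ, hχ, hχ1, hχ0, hχI⟩ := exists_contDiff_cutoff hK.isClosed isOpen_interior hKK'
  refine ⟨fun x => χ x • g x, K', hχ.smul hg, hK', hK'X, fun x hx => ?_, ?_⟩
  · simp only [hχ0 x fun h => hx (interior_subset h), zero_smul]
  · have hsplit : (u - fun x => χ x • g x) = (u - g) + fun x => (1 - χ x) • g x := by
      ext x
      simp [sub_smul]
    have hsmall : eLpNorm (fun x => (1 - χ x) • g x) 2 (volume.restrict X) ≤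
        ENNReal.ofReal (ε / 2) := by
      refine (eLpNorm_mono fun x => ?_).trans (hgδ Kᶜ hK.measurableSet.compl ?_)
      · by_cases hx : x ∈ K
        · simp [hχ1 x hx]
        · rw [indicator_of_mem (show x ∈ Kᶜ from hx), norm_smul, Real.norm_eq_abs,
            abs_of_nonneg (by linarith [(hχI x).2])]
          exact mul_le_of_le_one_left (norm_nonneg _) (by linarith [(hχI x).1])
      · rw [Measure.restrict_apply hK.measurableSet.compl, inter_comm, ← sdiff_eq]
        exact hKδ.le
    have hcont : Continuous fun x => (1 - χ x) • g x :=
      (continuous_const.sub hχ.continuous).smul hg.continuous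
    rw [hsplit]
    refine (eLpNorm_add_le (hu.1.sub hgm.1) hcont.aestronglyMeasurable (by simp)).trans ?_
    refine (add_le_add hug hsmall).trans_eq ?_
    rw [← ENNReal.ofReal_add (by positivity) (by positivity), add_halves]

/-- Multiplication with a cutoff function that is supported in a thin neighbourhood of a compact set
`A` makes the `L²`-norm small on a domain whose image by `f` does not meet `A`. -/
theorem eventually_eLpNorm_cutoff_smul_le {a b : ℕ} {G : Type*} [NormedAddCommGroup G]
    [NormedSpace ℝ G] {X : Set (Euc a)} (hX : IsOpen X) (hXb : Bornology.IsBounded X)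
    {f : Euc a → Euc b} (hf : ContinuousOn f X) {A : Set (Euc b)} (hA : IsCompact A)
    (hd : Disjoint A (f '' X)) {h : Euc a → G} (hh : MemLp h 2 (volume.restrict X))
    {ε : ℝ} (hε : 0 < ε) :
    ∀ᶠ r in 𝓝[>] (0 : ℝ), ∀ χ : Euc b → ℝ, (∀ y, χ y ∈ Icc 0 1) →
      (∀ y ∉ Metric.thickening r A, χ y = 0) →
      eLpNorm (fun x => χ (f x) • h x) 2 (volume.restrict X) ≤ ENNReal.ofReal ε := by
  obtain ⟨δ, hδ, hhδ⟩ := hh.eLpNorm_indicator_le (by simp) (by simp) hε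
  set s : ℝ → Set (Euc a) := fun r => X ∩ f ⁻¹' Metric.thickening r A
  have hso : ∀ r, IsOpen (s r) := fun r => hf.isOpen_inter_preimage hX Metric.isOpen_thickening
  have hinter : ⋂ r > (0 : ℝ), s r = ∅ := by
    refine eq_empty_of_forall_notMem fun x hx => ?_
    have hx' : ∀ r > (0 : ℝ), x ∈ s r := by simpa using hx
    have hfx : f x ∈ closure A := by
      rw [Metric.closure_eq_iInter_thickening]
      simpa using fun r hr => (hx' r hr).2
    rw [hA.isClosed.closure_eq] at hfx
    exact disjoint_left.1 hd hfx (mem_image_of_mem f (hx' 1 one_pos).1)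
  have hlim := tendsto_measure_biInter_gt (μ := volume) (s := s) (a := (0 : ℝ))
    (fun r _ => (hso r).measurableSet.nullMeasurableSet)
    (fun i j _ hij => inter_subset_inter_right _
      (preimage_mono (Metric.thickening_mono hij A)))
    ⟨1, one_pos, ((measure_mono inter_subset_left).trans_lt hXb.measure_lt_top).ne⟩
  rw [hinter, measure_empty] at hlim
  filter_upwards [hlim.eventually (gt_mem_nhds (ENNReal.ofReal_pos.2 hδ))] with r hr χ hχ hχ0
  have hle := hhδ (s r) (hso r).measurableSet ((Measure.restrict_apply_le _ _).trans hr.le)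
  refine le_trans (eLpNorm_mono_ae (ae_restrict_of_forall_mem hX.measurableSet fun x hx => ?_)) hle
  by_cases hxr : f x ∈ Metric.thickening r A
  · rw [indicator_of_mem (show x ∈ s r from ⟨hx, hxr⟩), norm_smul, Real.norm_eq_abs,
      abs_of_nonneg (hχ _).1]
    exact mul_le_of_le_one_left (norm_nonneg _) (hχ _).2
  · rw [hχ0 _ hxr, zero_smul, norm_zero]
    exact norm_nonneg _

/-- The square integrable forms on finitely many domains that are embedded with pairwise disjoint
images in one Euclidean space can be approximated simultaneously by the pull-backs of one smooth
form on that space. -/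
theorem exists_contDiff_pullback_eLpNorm_sub_le {J : Type*} [Fintype J] {d : J → ℕ} {b m : ℕ}
    {X : ∀ j, Set (Euc (d j))} (hX : ∀ j, IsOpen (X j))
    (hXb : ∀ j, Bornology.IsBounded (X j)) {f : ∀ j, Euc (d j) → Euc b}
    (hf : ∀ j, ContDiffOn ℝ ∞ (f j) (closure (X j))) (hinj : ∀ j, InjOn (f j) (closure (X j)))
    (hdiff : ∀ j, IsDiffeoOn (f j) (X j))
    (hdisj : Pairwise fun j l => Disjoint (f j '' X j) (f l '' X l))
    {u : ∀ j, Euc (d j) → AltForm (d j) m} (hu : ∀ j, MemLp (u j) 2 (volume.restrict (X j)))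
    {ε : ℝ} (hε : 0 < ε) :
    ∃ B : Euc b → AltForm b m, ContDiff ℝ ∞ B ∧
      ∀ j, eLpNorm (fun x => u j x - (B (f j x)).compContinuousLinearMap (fderiv ℝ (f j) x)) 2
        (volume.restrict (X j)) ≤ ENNReal.ofReal ε := by
  classical
  have hXc : ∀ j, IsCompact (closure (X j)) := fun j => (hXb j).isCompact_closure
  choose c K hc hK hKX hcK hcu using fun j =>
    exists_contDiff_compact_eLpNorm_sub_le (hX j) (hXb j) (hu j) (half_pos hε)
  choose B hB hBc using fun j => exists_contDiff_pullback_eq (hX j) (hXc j) (hf j) (hinj j)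
    (hdiff j) (hK j) (hKX j) (hc j) (hcK j)
  -- the pull-back of `B j` to the domain `l`
  let P : ∀ j l, Euc (d l) → AltForm (d l) m := fun j l x =>
    (B j (f l x)).compContinuousLinearMap (fderiv ℝ (f l) x)
  have hP : ∀ j l, MemLp (P j l) 2 (volume.restrict (X l)) := by
    intro j l
    obtain ⟨D, hD, hDf⟩ := exists_contDiffOn_eq_fderiv (hX l) (hf l)
    have hQ := ((hB j).comp_contDiffOn (hf l)).compContinuousLinearMap_altForm hD
    obtain ⟨C, hC⟩ := (hXc l).exists_bound_of_continuousOn hQ.continuousOn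
    have hPQ : ∀ x ∈ X l, P j l x = (B j (f l x)).compContinuousLinearMap (D x) := fun x hx => by
      simp only [P, hDf x hx]
    refine memLp_two_of_continuousOn_of_bound (hX l) (hXb l) (C := C)
      ((hQ.continuousOn.mono subset_closure).congr hPQ) fun x hx => ?_
    rw [hPQ x hx]
    exact hC x (subset_closure hx)
  set A : J → Set (Euc b) := fun j => f j '' K j
  have hA : ∀ j, IsCompact (A j) := fun j =>
    (hK j).image_of_continuousOn ((hf j).continuousOn.mono ((hKX j).trans subset_closure))
  set η : ℝ := ε / 2 / (Fintype.card J + 1) with hη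
  have hη0 : 0 < η := by positivity
  have hev : ∀ᶠ r in 𝓝[>] (0 : ℝ), ∀ j l, l ≠ j → ∀ χ : Euc b → ℝ, (∀ y, χ y ∈ Icc 0 1) →
      (∀ y ∉ Metric.thickening r (A j), χ y = 0) →
      eLpNorm (fun x => χ (f l x) • P j l x) 2 (volume.restrict (X l)) ≤ ENNReal.ofReal η := by
    refine eventually_all.2 fun j => eventually_all.2 fun l => ?_
    by_cases hlj : l = j
    · exact Eventually.of_forall fun r h => absurd hlj h
    · refine (eventually_eLpNorm_cutoff_smul_le (hX l) (hXb l)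
        ((hf l).continuousOn.mono subset_closure) (hA j) ?_ (hP j l) hη0).mono fun r h _ => h
      exact (hdisj (Ne.symm hlj)).mono_left (image_mono (hKX j))
  obtain ⟨r, hr, hr0⟩ := (hev.and self_mem_nhdsWithin).exists
  choose χ hχ hχ1 hχ0 hχI using fun j => exists_contDiff_cutoff (hA j).isClosed
    (Metric.isOpen_thickening (δ := r)) (Metric.self_subset_thickening hr0 (A j))
  refine ⟨fun y => ∑ j, χ j y • B j y, ContDiff.sum fun j _ => (hχ j).smul (hB j), fun l => ?_⟩
  have hpull : ∀ x, (∑ j, χ j (f l x) • B j (f l x)).compContinuousLinearMap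
      (fderiv ℝ (f l) x) = ∑ j, χ j (f l x) • P j l x := fun x => by
    ext v
    simp [P]
  -- on the domain `l`, the cutoff function does not change the pull-back of `B l`
  have hown : ∀ x ∈ X l, χ l (f l x) • P l l x = c l x := fun x hx => by
    have hPc : P l l x = c l x := hBc l x hx
    rw [hPc]
    by_cases hxK : x ∈ K l
    · rw [hχ1 l _ (mem_image_of_mem _ hxK), one_smul]
    · rw [hcK l x hxK, smul_zero]
  have hae : (fun x => u l x - (∑ j, χ j (f l x) • B j (f l x)).compContinuousLinearMap
      (fderiv ℝ (f l) x)) =ᵐ[volume.restrict (X l)]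
      (u l - c l) - ∑ j ∈ Finset.univ.erase l, fun x => χ j (f l x) • P j l x := by
    refine ae_restrict_of_forall_mem (hX l).measurableSet fun x hx => ?_
    beta_reduce
    rw [hpull, ← Finset.add_sum_erase _ _ (Finset.mem_univ l), hown x hx]
    simp only [Pi.sub_apply, Finset.sum_apply]
    abel
  have hmeas : ∀ j, AEStronglyMeasurable (fun x => χ j (f l x) • P j l x)
      (volume.restrict (X l)) := fun j =>
    AEStronglyMeasurable.smul (((hχ j).continuous.comp_continuousOn
      ((hf l).continuousOn.mono subset_closure)).aestronglyMeasurable (hX l).measurableSet)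
      (hP j l).1
  rw [eLpNorm_congr_ae hae]
  refine (eLpNorm_sub_le ((hu l).1.sub (hc l).continuous.aestronglyMeasurable)
    (Finset.aestronglyMeasurable_sum _ fun j _ => hmeas j) (by simp)).trans ?_
  have hsum : eLpNorm (∑ j ∈ Finset.univ.erase l, fun x => χ j (f l x) • P j l x) 2
      (volume.restrict (X l)) ≤ ENNReal.ofReal (ε / 2) := by
    refine (eLpNorm_sum_le (fun j _ => hmeas j) (by simp)).trans ?_
    calc _ ≤ ∑ _j ∈ Finset.univ.erase l, ENNReal.ofReal η :=
          Finset.sum_le_sum fun j hj =>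
            hr j l (Finset.ne_of_mem_erase hj).symm (χ j) (hχI j) (hχ0 j)
      _ ≤ ∑ _j : J, ENNReal.ofReal η :=
          Finset.sum_le_sum_of_subset (Finset.subset_univ _)
      _ = ENNReal.ofReal (Fintype.card J * η) := by
          rw [Finset.sum_const, Finset.card_univ, nsmul_eq_mul,
            ENNReal.ofReal_mul (Nat.cast_nonneg _), ENNReal.ofReal_natCast]
      _ ≤ ENNReal.ofReal (ε / 2) := by
          refine ENNReal.ofReal_le_ofReal ?_
          have : ((Fintype.card J : ℝ) + 1) * η = ε / 2 := by
            rw [hη]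
            field_simp
          linarith
  refine (add_le_add (hcu l) hsum).trans_eq ?_
  rw [← ENNReal.ofReal_add (by positivity) (by positivity), add_halves]

/-! ### Square integrable mixed-dimensional forms -/

theorem memLp_of_forall_coefMap {a d m : ℕ} {μ : Measure (Euc a)} {w : Euc a → AltForm d m}
    (h : ∀ σ, MemLp (fun x => coefMap d m (w x) σ) 2 μ) : MemLp w 2 μ := by
  obtain ⟨R, hR⟩ := exists_leftInverse_coefMap d m
  have h1 : MemLp (fun x => R (coefMap d m (w x))) 2 μ := R.comp_memLp' (MemLp.of_eval h)
  simpa only [hR] using h1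

theorem MeasureTheory.MemLp.integral_norm_sq_le {a : ℕ} {G : Type*} [NormedAddCommGroup G]
    {μ : Measure (Euc a)} {w : Euc a → G} (hw : MemLp w 2 μ) {η : ℝ} (hη : 0 ≤ η)
    (h : eLpNorm w 2 μ ≤ ENNReal.ofReal η) : ∫ x, ‖w x‖ ^ 2 ∂μ ≤ η ^ 2 := by
  rw [hw.eLpNorm_eq_integral_rpow_norm (by simp) (by simp), ENNReal.ofReal_le_ofReal_iff hη] at h
  have h0 : 0 ≤ ∫ x, ‖w x‖ ^ 2 ∂μ := integral_nonneg fun x => by positivity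
  simp only [ENNReal.toReal_ofNat, Real.rpow_ofNat] at h
  rw [← one_div, ← Real.sqrt_eq_rpow] at h
  rwa [Real.sqrt_le_left hη] at h

namespace ConformingForest

variable {n : ℕ} {I : Type*} {J : I → Type*} [∀ i, PartialOrder (J i)] [∀ i, OrderTop (J i)]
variable (F : ConformingForest n I J)

theorem X_subset (i : I) (j : J i) : F.X i j ⊆ closure (F.X i j) \ F.φ₀ i j ⁻¹' F.bdD := by
  rw [← F.cover i j]
  intro x hx
  exact mem_biUnion (mem_Iic.2 le_rfl) ⟨x, hx, F.φ_self i j (subset_closure hx)⟩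

theorem IsSmoothLocal.memLp {m : ℕ} {i : I} {j : J i}
    {w : Euc (F.dim i j) → AltForm (F.dim i j) m} (hw : F.IsSmoothLocal i j w) :
    MemLp w 2 (volume.restrict (F.X i j)) := by
  obtain ⟨C, hC⟩ := hw.2 0
  refine memLp_two_of_continuousOn_of_bound (F.X_isOpen i j) (F.X_isBounded i j)
    (hw.1.continuousOn.mono (F.X_subset i j)) (C := C) fun x hx => ?_
  rw [← norm_iteratedFDeriv_zero (𝕜 := ℝ)]
  exact hC x hx

theorem CForms_subset_L2Forms (k : ℕ) : F.CForms k ⊆ F.L2Forms k := by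
  rintro a ⟨ha, hs, -⟩
  refine ⟨ha, fun i j σ => ?_⟩
  exact (ContinuousLinearMap.proj (R := ℝ) σ ∘L
    LinearMap.toContinuousLinearMap (coefMap _ _)).comp_memLp' (hs i j).memLp

theorem isSmoothLocal_of_contDiffOn {m : ℕ} {i : I} {j : J i}
    {w : Euc (F.dim i j) → AltForm (F.dim i j) m} (hw : ContDiffOn ℝ ∞ w (closure (F.X i j))) :
    F.IsSmoothLocal i j w :=
  ⟨hw.mono sdiff_subset, exists_norm_iteratedFDeriv_le (F.X_isOpen i j)
    (F.X_isBounded i j).isCompact_closure hw⟩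

theorem contDiffOn_φ_top (i : I) (j : J i) : ContDiffOn ℝ ∞ (F.φ i ⊤ j) (closure (F.X i j)) := by
  rcases eq_or_ne j ⊤ with rfl | hj
  · exact contDiffOn_id.congr (F.φ_self i ⊤)
  · exact F.φ_smooth i ⊤ j (lt_top_iff_ne_top.2 hj)

theorem injOn_φ_top (i : I) (j : J i) : InjOn (F.φ i ⊤ j) (closure (F.X i j)) := by
  rcases eq_or_ne j ⊤ with rfl | hj
  · exact (injOn_id _).congr (F.φ_self i ⊤).symm
  · exact F.φ_injOn i ⊤ j (lt_top_iff_ne_top.2 hj)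

theorem isDiffeoOn_φ_top (i : I) (j : J i) : IsDiffeoOn (F.φ i ⊤ j) (F.X i j) := by
  rcases eq_or_ne j ⊤ with rfl | hj
  · exact ⟨(F.contDiffOn_φ_top i ⊤).mono subset_closure, id, contDiffOn_id,
      fun x hx => F.φ_self i ⊤ (subset_closure hx)⟩
  · exact F.φ_diffeo i ⊤ j (lt_top_iff_ne_top.2 hj)

theorem trace_top {m : ℕ} (i : I) (w : Euc (F.dim i ⊤) → AltForm (F.dim i ⊤) m)
    {x : Euc (F.dim i ⊤)} (hx : x ∈ F.X i ⊤) : F.trace i ⊤ w x = w x := by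
  have h : HasFDerivAt (F.φ i ⊤ ⊤) (ContinuousLinearMap.id ℝ _) x :=
    (hasFDerivAt_id x).congr_of_eventuallyEq (eventually_of_mem ((F.X_isOpen i ⊤).mem_nhds hx)
      fun y hy => F.φ_self i ⊤ (subset_closure hy))
  rw [trace, h.fderiv, F.φ_self i ⊤ (subset_closure hx)]
  ext v
  simp

theorem relOrient_mul_self (i : I) (j : J i) : F.relOrient i j * F.relOrient i j = 1 := by
  unfold relOrient
  split_ifs <;> norm_num

/-- Density for a single tree: the form on the root is the smooth form whose traces approximate the
given forms up to the relative orientation, and it determines the forms on the other nodes. -/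
theorem exists_tree_eLpNorm_sub_le {m : ℕ} (i : I) [Fintype (J i)]
    {a : ∀ j : J i, Euc (F.dim i j) → AltForm (F.dim i j) m}
    (ha : ∀ j, MemLp (a j) 2 (volume.restrict (F.X i j))) {η : ℝ} (hη : 0 < η) :
    ∃ b : ∀ j : J i, Euc (F.dim i j) → AltForm (F.dim i j) m,
      (∀ j, F.IsSmoothLocal i j (b j)) ∧
      (∀ j, j ≠ ⊤ → ∀ x ∈ F.X i j, b j x = F.relOrient i j • F.trace i j (b ⊤) x) ∧
      ∀ j, eLpNorm (a j - b j) 2 (volume.restrict (F.X i j)) ≤ ENNReal.ofReal η := by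
  classical
  -- the sign relating the form on a node to the trace of the form on the root
  let s : J i → ℝ := fun j => if j = ⊤ then 1 else F.relOrient i j
  have hs : ∀ j, s j * s j = 1 := fun j => by
    simp only [s]
    split_ifs
    · norm_num
    · exact F.relOrient_mul_self i j
  obtain ⟨B, hB, hBa⟩ := exists_contDiff_pullback_eLpNorm_sub_le (F.X_isOpen i) (F.X_isBounded i)
    (F.contDiffOn_φ_top i) (F.injOn_φ_top i) (F.isDiffeoOn_φ_top i)
    (fun j l hjl => F.cover_unique i ⊤ (mem_Iic.2 le_top) (mem_Iic.2 le_top) hjl)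
    (fun j => (ha j).const_smul (s j)) hη
  have hex : ∀ j, ∃ P : Euc (F.dim i j) → AltForm (F.dim i j) m,
      ContDiffOn ℝ ∞ P (closure (F.X i j)) ∧ ∀ x ∈ F.X i j, P x = s j • F.trace i j B x := by
    intro j
    obtain ⟨D, hD, hDf⟩ := exists_contDiffOn_eq_fderiv (F.X_isOpen i j) (F.contDiffOn_φ_top i j)
    refine ⟨_, ((hB.comp_contDiffOn
      (F.contDiffOn_φ_top i j)).compContinuousLinearMap_altForm hD).const_smul (s j),
      fun x hx => ?_⟩
    simp only [hDf x hx, trace, Function.comp_apply]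
  choose P hP hPt using hex
  have htop : Function.update P ⊤ B ⊤ = B := Function.update_self ..
  have hb : ∀ j, ∀ x ∈ F.X i j, Function.update P ⊤ B j x = s j • F.trace i j B x := by
    intro j x hx
    rcases eq_or_ne j ⊤ with rfl | hj
    · rw [htop, F.trace_top i B hx]
      simp [s]
    · rw [Function.update_of_ne hj]
      exact hPt j x hx
  refine ⟨Function.update P ⊤ B, fun j => ?_, fun j hj x hx => ?_, fun j => ?_⟩
  · rcases eq_or_ne j ⊤ with rfl | hj
    · rw [htop]
      exact F.isSmoothLocal_of_contDiffOn hB.contDiffOn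
    · rw [Function.update_of_ne hj]
      exact F.isSmoothLocal_of_contDiffOn (hP j)
  · rw [hb j x hx, htop]
    simp [s, hj]
  · refine (eLpNorm_congr_norm_ae (ae_restrict_of_forall_mem (F.X_isOpen i j).measurableSet
      fun x hx => ?_)).trans_le (hBa j)
    have h1 : (s j • a j) x - F.trace i j B x = s j • (a j x - Function.update P ⊤ B j x) := by
      rw [hb j x hx, smul_sub, smul_smul, hs, one_smul]
      rfl
    have h2 : ‖s j‖ = 1 := by
      have : ‖s j‖ * ‖s j‖ = 1 := by rw [← norm_mul, hs, norm_one]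
      nlinarith [norm_nonneg (s j)]
    change ‖a j x - Function.update P ⊤ B j x‖ = ‖(s j • a j) x - F.trace i j B x‖
    rw [h1, norm_smul, h2, one_mul]

theorem exists_mem_CForms_eLpNorm_sub_le [∀ i, Fintype (J i)] {k : ℕ} {a : F.Family k}
    (ha : a ∈ F.L2Forms k) {η : ℝ} (hη : 0 < η) :
    ∃ b ∈ F.CForms k, ∀ i j,
      eLpNorm (a i j - b i j) 2 (volume.restrict (F.X i j)) ≤ ENNReal.ofReal η := by
  classical
  choose b hb hbt hba using fun i => F.exists_tree_eLpNorm_sub_le i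
    (fun j => memLp_of_forall_coefMap (ha.2 i j)) hη
  -- on trees of negative degree the local forms have to vanish
  refine ⟨fun i => if k + F.dim i ⊤ < n then 0 else b i, ⟨fun i hi => if_pos hi, fun i j => ?_,
    fun i j hj x hx => ?_⟩, fun i j => ?_⟩
  · by_cases hi : k + F.dim i ⊤ < n
    · simp only [if_pos hi]
      exact F.isSmoothLocal_of_contDiffOn contDiffOn_const
    · simp only [if_neg hi]
      exact hb i j
  · by_cases hi : k + F.dim i ⊤ < n
    · simp only [if_pos hi]
      ext v
      simp [trace]
    · simp only [if_neg hi]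
      exact hbt i j hj x hx
  · by_cases hi : k + F.dim i ⊤ < n
    · simp only [if_pos hi, ha.1 i hi]
      have h0 : eLpNorm ((0 : F.Family k) i j - (0 : F.Family k) i j) 2
          (volume.restrict (F.X i j)) = eLpNorm (fun _ => (0 : ℝ)) 2 (volume.restrict (F.X i j)) :=
        eLpNorm_congr_norm_ae (.of_forall fun x => by simp)
      refine (h0.trans eLpNorm_zero').trans_le bot_le
    · simp only [if_neg hi]
      exact hba i j

end ConformingForest

theorem mainTheorem8 (n : ℕ) {I : Type*} {J : I → Type*} [Fintype I] [∀ i, Fintype (J i)]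
    [∀ i, PartialOrder (J i)] [∀ i, OrderTop (J i)]
    (F : ConformingForest n I J) (k : ℕ) :
    F.CForms k ⊆ F.L2Forms k ∧
      ∀ a ∈ F.L2Forms k, ∀ ε : ℝ, 0 < ε → ∃ b ∈ F.CForms k, F.normL2 (a - b) < ε := by
  refine ⟨F.CForms_subset_L2Forms k, fun a ha ε hε => ?_⟩
  choose C hC0 hC using fun i (j : J i) => exists_sum_coefMap_sq_le (F.dim i j) (F.deg k i)
  set S : ℝ := ∑ i, ∑ j, C i j with hS
  have hS0 : 0 ≤ S := Finset.sum_nonneg fun i _ => Finset.sum_nonneg fun j _ => (hC0 i j).le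
  obtain ⟨b, hb, hab⟩ := F.exists_mem_CForms_eLpNorm_sub_le ha
    (show 0 < ε / (S + 1) by positivity)
  refine ⟨b, hb, ?_⟩
  have hterm : ∀ i j, ∫ x in F.X i j, ∑ σ, ConformingForest.coef ((a - b) i j) σ x *
      ConformingForest.coef ((a - b) i j) σ x ≤ C i j * (ε / (S + 1)) ^ 2 := by
    intro i j
    have hm : MemLp (a i j - b i j) 2 (volume.restrict (F.X i j)) :=
      (memLp_of_forall_coefMap (ha.2 i j)).sub (hb.2.1 i j).memLp
    calc _ ≤ ∫ x in F.X i j, C i j * ‖(a i j - b i j) x‖ ^ 2 := by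
          refine integral_mono_of_nonneg (.of_forall fun x => Finset.sum_nonneg fun σ _ =>
            mul_self_nonneg _) (hm.norm.integrable_sq.const_mul _) (.of_forall fun x => ?_)
          refine le_trans (le_of_eq ?_) (hC i j ((a i j - b i j) x))
          exact Finset.sum_congr rfl fun σ _ => (pow_two _).symm
      _ = C i j * ∫ x in F.X i j, ‖(a i j - b i j) x‖ ^ 2 := integral_const_mul _ _
      _ ≤ _ := mul_le_mul_of_nonneg_left (hm.integral_norm_sq_le (by positivity) (hab i j))
          (hC0 i j).le
  rw [ConformingForest.normL2, Real.sqrt_lt' hε]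
  calc F.innerL2 (a - b) (a - b) ≤ ∑ i, ∑ j, C i j * (ε / (S + 1)) ^ 2 :=
        Finset.sum_le_sum fun i _ => Finset.sum_le_sum fun j _ => hterm i j
    _ = S * (ε / (S + 1)) ^ 2 := by simp only [hS, Finset.sum_mul]
    _ < ε ^ 2 := by
        rw [div_pow, mul_div_assoc', div_lt_iff₀ (by positivity), mul_comm]
        exact mul_lt_mul_of_pos_left (by nlinarith) (by positivity)
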